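/- Let $\Gamma$ be a countable group with identity $e$, equipped with a left-invariant distance $d$ that is proper (all balls are finite), and write $|g| = d(g,e)$. Let $\mu$ be a probability measure on $\Gamma$ that is symmetric, i.e. $\mu(g^{-1}) = \mu(g)$ for all $g$, and has finite entropy $-\sum_g \mu(g)\log\mu(g) < \infty$. Let $\mu^{*n}$ denote the $n$-fold convolution of $\mu$, and let $$\rho = \limsup_{n\to\infty} \big(\mu^{*n}(e)\big)^{1/n}, \qquad h = \lim_{n\to\infty} -\frac1n \sum_{g\in\Gamma} \mu^{*n}(g)\log \mu^{*n}(g)$$ be the spectral radius and the asymptotic entropy of the random walk. Then every $\mu^{*n}$ has finite entropy, the limit defining $h$ exists and is finite, $0<\rho\le 1$, and $$2\sqrt{1-\rho^2}\,\operatorname{artanh}\sqrt{1-\rho^2} \;\le\; h.$$ If moreover $\mu$ has finite second moment, i.e. $M_2(\mu) = \big(\sum_g |g|^2\mu(g)\big)^{1/2} < \infty$, then every $\mu^{*n}$ has finite first moment, the limit $$\ell = \lim_{n\to\infty} \frac1n \sum_{g\in\Gamma} |g|\,\mu^{*n}(g)$$ (the drift) exists and is finite, and $\tilde\ell = \ell/M_2(\mu)$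 (read as $0$ if $M_2(\mu)=0$, i.e. if $\mu=\delta_e$) satisfies $0\le\tilde\ell<1$ and $$2\,\tilde\ell\,\operatorname{artanh}\tilde\ell \;\le\; h.$$ -/

import Mathlib

noncomputable section

namespace GroupWalk

/-- The convolution `μ * ν` of two probability measures on a group: the law of `a * b`, where
`a` and `b` are independent with laws `μ` and `ν`. -/
def conv {Γ : Type*} [Group Γ] (μ ν : PMF Γ) : PMF Γ :=
  μ.bind fun a => ν.map fun b => a * b

/-- The `n`-fold convolution `μ^{*n}`, the law of `X_n = γ₁ ⋯ γ_n`. -/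
def convPow {Γ : Type*} [Group Γ] (μ : PMF Γ) : ℕ → PMF Γ
  | 0 => PMF.pure 1
  | n + 1 => conv (convPow μ n) μ

/-- The measure `μ` is symmetric: `μ(g⁻¹) = μ(g)`. -/
def IsSymmetric {Γ : Type*} [Group Γ] (μ : PMF Γ) : Prop :=
  ∀ g : Γ, μ g⁻¹ = μ g

/-- The series of nonnegative terms `-∑ μ(g) log μ(g)` converges. -/
def FiniteEntropy {Γ : Type*} (μ : PMF Γ) : Prop :=
  Summable fun g : Γ => -((μ g).toReal * Real.log (μ g).toReal)

/-- The entropy `H(μ) = -∑ μ(g) log μ(g)`. -/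
def entropy {Γ : Type*} (μ : PMF Γ) : ℝ :=
  ∑' g : Γ, -((μ g).toReal * Real.log (μ g).toReal)

/-- The asymptotic entropy `h = lim_n H(μ^{*n}) / n`. -/
def asymptoticEntropy {Γ : Type*} [Group Γ] (μ : PMF Γ) : ℝ :=
  Filter.limUnder Filter.atTop fun n : ℕ => entropy (convPow μ n) / n

/-- The spectral radius `ρ = limsup_n μ^{*n}(e)^{1/n}`. -/
def spectralRad {Γ : Type*} [Group Γ] (μ : PMF Γ) : ℝ :=
  Filter.limsup (fun n : ℕ => (convPow μ n 1).toReal ^ (1 / (n : ℝ))) Filter.atTop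

/-- The distance is invariant under left translations. -/
def LeftInvariantDist (Γ : Type*) [Group Γ] [MetricSpace Γ] : Prop :=
  ∀ g x y : Γ, dist (g * x) (g * y) = dist x y

/-- The distance is proper: balls are finite. -/
def ProperDist (Γ : Type*) [MetricSpace Γ] : Prop :=
  ∀ (x : Γ) (r : ℝ), (Metric.closedBall x r).Finite

/-- The length `|g| = dist(g, e)`. -/
def len {Γ : Type*} [Group Γ] [MetricSpace Γ] (g : Γ) : ℝ := dist g 1

/-- `∑ |g| μ(g)` converges. -/
def FiniteFirstMoment {Γ : Type*} [Group Γ] [MetricSpace Γ] (μ : PMF Γ) : Prop :=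
  Summable fun g : Γ => len g * (μ g).toReal

/-- `∑ |g|² μ(g)` converges. -/
def FiniteSecondMoment {Γ : Type*} [Group Γ] [MetricSpace Γ] (μ : PMF Γ) : Prop :=
  Summable fun g : Γ => len g ^ 2 * (μ g).toReal

/-- The mean length `∑ |g| μ(g)`. -/
def meanLength {Γ : Type*} [Group Γ] [MetricSpace Γ] (μ : PMF Γ) : ℝ :=
  ∑' g : Γ, len g * (μ g).toReal

/-- `M₂(μ) = (∑ |g|² μ(g))^{1/2}`. -/
def M2 {Γ : Type*} [Group Γ] [MetricSpace Γ] (μ : PMF Γ) : ℝ :=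
  Real.sqrt (∑' g : Γ, len g ^ 2 * (μ g).toReal)

/-- The drift `ℓ = lim_n (1/n) ∑ |g| μ^{*n}(g)`. -/
def drift {Γ : Type*} [Group Γ] [MetricSpace Γ] (μ : PMF Γ) : ℝ :=
  Filter.limUnder Filter.atTop fun n : ℕ => meanLength (convPow μ n) / n

/-- The normalized drift `ℓ / M₂(μ)`. If `M₂(μ) = 0`, then `μ` is the point mass at the
identity, and the value is `0`. -/
def normDrift {Γ : Type*} [Group Γ] [MetricSpace Γ] (μ : PMF Γ) : ℝ :=
  drift μ / M2 μ

end GroupWalk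

end

/-! Both inequalities come from the entropy production of the normalized Green measures `ν = ∑ (1 -
a) aⁿ μ^{*n}`. The resolvent identity `ν = (1 - a) δ_e + a ν * μ`, tested against `F` and
symmetrized over the edges `{x, xg}`, gives (`hasSum_energy`) `∑ μ(g) (ν(x) - ν(xg)) (F(xg) - F(x))
= 2 (1 - a)/a · (∑ ν F - F(e))`. For `F = -log ν` the right side is at most `2 (1 - a)/a · H(ν)`.
Since `H(ν)` is at most the mean of `H(μ^{*n})` plus the entropy of the geometric law, `(1 - a)/a ·
H(ν)` is asymptotically at most `h` as `a → 1` (`le_asymptoticEntropy`). For `F = |·|` the right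
side is at least `2ℓ` (`drift_le_green`).

It remains to bound the left side below for `F = -log ν`. On one edge write `A = ν(x)`, `B = ν(xg)`,
`s = (log A - log B)/2`. Then `A - B = (A + B) tanh s`, `2√(AB) = (A + B)/cosh s`, and the entropy
production is `(A + B) · 2 s tanh s`. The weights `μ(g)(A + B)` have total mass 2. As `2 s tanh s`
is convex in `1/cosh s` and in `tanh² s`, tangent lines replace Jensen's inequality.

For the spectral bound, the mean of `1/cosh s` is at most `ρ`, because `√ν` is a unit vector of `ℓ²`
and the Markov operator has norm at most `ρ` (`sum_sqrt_le`). For the drift bound, the energy of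
`|·|` and Cauchy–Schwarz force the mean of `tanh² s` to be at least `(ℓ/M₂)²`. -/

namespace GroupWalk

/-! ### Tangent-line inequalities in hyperbolic coordinates -/

open Real

/-- The function `s coth s` is monotone on the positive half-line. -/
lemma monotoneOn_mul_cosh_div_sinh :
    MonotoneOn (fun s : ℝ => s * cosh s / sinh s) (Set.Ioi 0) := by
  have hd : ∀ s ∈ Set.Ioi (0 : ℝ), HasDerivAt (fun s : ℝ => s * cosh s / sinh s)
      (((1 * cosh s + s * sinh s) * sinh s - s * cosh s * cosh s) / sinh s ^ 2) s := fun s hs =>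
    ((hasDerivAt_id' s).mul (hasDerivAt_cosh s)).div (hasDerivAt_sinh s)
      (sinh_pos_iff.2 hs).ne'
  refine monotoneOn_of_deriv_nonneg (convex_Ioi 0)
    (fun s hs => (hd s hs).continuousAt.continuousWithinAt) ?_ ?_
  · rw [interior_Ioi]
    exact fun s hs => (hd s hs).differentiableAt.differentiableWithinAt
  · rw [interior_Ioi]
    intro s hs
    rw [(hd s hs).deriv]
    have h0 : 0 < s := hs
    have h1 : s ≤ sinh s := self_le_sinh_iff.2 h0.le
    have h2 : 1 ≤ cosh s := one_le_cosh s
    have h3 := cosh_sq s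
    refine div_nonneg ?_ (sq_nonneg _)
    -- The numerator equals `sinh s cosh s - s`, which is at least `sinh s - s`.
    nlinarith [mul_nonneg (h0.le.trans h1) (sub_nonneg.2 h2)]

/-- A function that decreases before `s₀` and increases after `s₀` is minimal at `s₀`. -/
lemma le_of_deriv_sign {f f' : ℝ → ℝ} {s₀ : ℝ} (h₀ : 0 ≤ s₀)
    (hf : ∀ s, HasDerivAt f (f' s) s) (hneg : ∀ s, 0 < s → s < s₀ → f' s ≤ 0)
    (hpos : ∀ s, s₀ < s → 0 ≤ f' s) {s : ℝ} (hs : 0 ≤ s) : f s₀ ≤ f s := by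
  have hc : Continuous f := continuous_iff_continuousAt.2 fun s => (hf s).continuousAt
  rcases le_total s s₀ with h | h
  · refine antitoneOn_of_deriv_nonpos (convex_Icc 0 s₀) hc.continuousOn
      (fun x _ => (hf x).differentiableAt.differentiableWithinAt) (fun x hx => ?_)
      ⟨hs, h⟩ ⟨h₀, le_rfl⟩ h
    rw [interior_Icc] at hx
    rw [(hf x).deriv]
    exact hneg x hx.1 hx.2
  · refine monotoneOn_of_deriv_nonneg (convex_Ici s₀) hc.continuousOn
      (fun x _ => (hf x).differentiableAt.differentiableWithinAt) (fun x hx => ?_)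
      (Set.self_mem_Ici) h h
    rw [interior_Ici] at hx
    rw [(hf x).deriv]
    exact hpos x hx

/-- The tangent line inequality for `2 s tanh s`, a convex function of `1 / cosh s`. -/
lemma tangent_inv_cosh {s₀ : ℝ} (h₀ : 0 < s₀) (s : ℝ) :
    2 * s₀ * tanh s₀ + (2 * cosh s₀ + 2 * s₀ / sinh s₀) * (1 / cosh s₀ - 1 / cosh s) ≤
      2 * s * tanh s := by
  wlog hs : 0 ≤ s generalizing s
  · have := this (-s) (by linarith)
    rw [tanh_neg, cosh_neg] at this
    linarith
  have hS : 0 < sinh s₀ := sinh_pos_iff.2 h₀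
  have hC : 0 < cosh s₀ := cosh_pos s₀
  have hc : 0 < cosh s := cosh_pos s
  -- Multiplying the claim by `cosh s / 2` turns it into minimality at `s₀` of `s sinh s - (1 + m)
  -- cosh s`. Its derivative is `sinh s (s coth s - m)`, so `m = s₀ coth s₀` places the sign change
  -- at `s₀`.
  set m := s₀ * cosh s₀ / sinh s₀ with hm
  have key := le_of_deriv_sign (f := fun s => s * sinh s - (1 + m) * cosh s)
    (f' := fun s => (1 * sinh s + s * cosh s) - (1 + m) * sinh s) h₀.le
    (fun s => ((hasDerivAt_id' s).mul (hasDerivAt_sinh s)).sub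
      ((hasDerivAt_cosh s).const_mul _)) ?_ ?_ hs
  · have e : 2 * s * tanh s - (2 * s₀ * tanh s₀ + (2 * cosh s₀ + 2 * s₀ / sinh s₀) *
        (1 / cosh s₀ - 1 / cosh s)) =
        2 / cosh s * ((s * sinh s - (1 + m) * cosh s) -
          (s₀ * sinh s₀ - (1 + m) * cosh s₀)) := by
      have hq := cosh_sq s₀
      rw [tanh_eq_sinh_div_cosh, tanh_eq_sinh_div_cosh, hm]
      field_simp
      have h3 : cosh s₀ ^ 3 = cosh s₀ * (sinh s₀ ^ 2 + 1) := by rw [← hq]; ring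
      ring_nf
      rw [h3, hq]
      ring
    have : 0 ≤ 2 / cosh s * ((s * sinh s - (1 + m) * cosh s) -
          (s₀ * sinh s₀ - (1 + m) * cosh s₀)) :=
      mul_nonneg (by positivity) (sub_nonneg.2 key)
    linarith
  · intro s hs hs'
    have := monotoneOn_mul_cosh_div_sinh hs h₀ hs'.le
    have hp : 0 < sinh s := sinh_pos_iff.2 hs
    simp only at this
    rw [← hm, div_le_iff₀ hp] at this
    linarith
  · intro s hs'
    have hs : 0 < s := h₀.trans hs'
    have := monotoneOn_mul_cosh_div_sinh h₀ hs hs'.le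
    have hp : 0 < sinh s := sinh_pos_iff.2 hs
    simp only at this
    rw [← hm, le_div_iff₀ hp] at this
    linarith

/-- The tangent line inequality for `2 s tanh s`, a convex function of `tanh² s`. -/
lemma tangent_tanh_sq {s₀ : ℝ} (h₀ : 0 < s₀) (s : ℝ) :
    2 * s₀ * tanh s₀ + (cosh s₀ ^ 2 + s₀ * cosh s₀ / sinh s₀) * (tanh s ^ 2 - tanh s₀ ^ 2) ≤
      2 * s * tanh s := by
  wlog hs : 0 ≤ s generalizing s
  · have := this (-s) (by linarith)
    rw [tanh_neg] at this
    linarith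
  -- `K` is the slope at `s₀` of `2 s tanh s` with respect to `tanh² s`. This slope increases with
  -- `s`, which is the convexity.
  set K := cosh s₀ ^ 2 + s₀ * cosh s₀ / sinh s₀ with hK
  have hd : ∀ s, HasDerivAt tanh (1 / cosh s ^ 2) s := fun s => by
    have h := (hasDerivAt_sinh s).div (hasDerivAt_cosh s) (cosh_pos s).ne'
    have e : tanh = fun s => sinh s / cosh s := funext tanh_eq_sinh_div_cosh
    rw [e]
    refine HasDerivAt.congr_deriv (f' := _) h ?_
    congr 1
    have := cosh_sq s
    linarith
  have hsign : ∀ s, 0 < s → (2 * (1 * tanh s + s * (1 / cosh s ^ 2)) -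
      K * (2 * tanh s * (1 / cosh s ^ 2))) =
      2 * sinh s / cosh s ^ 3 * (cosh s ^ 2 + s * cosh s / sinh s - K) := fun s hs => by
    have hp : 0 < sinh s := sinh_pos_iff.2 hs
    have hc := cosh_pos s
    rw [tanh_eq_sinh_div_cosh]
    field_simp
  have hmono : ∀ s t, 0 < s → s ≤ t → cosh s ^ 2 + s * cosh s / sinh s ≤
      cosh t ^ 2 + t * cosh t / sinh t := fun s t hs hst => by
    have h1 := monotoneOn_mul_cosh_div_sinh hs (hs.trans_le hst) hst
    have h2 : cosh s ≤ cosh t := by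
      rw [cosh_le_cosh, abs_of_pos hs, abs_of_pos (hs.trans_le hst)]; exact hst
    have h3 := cosh_pos s
    simp only at h1
    gcongr
  have key := le_of_deriv_sign (f := fun s => 2 * (s * tanh s) - K * tanh s ^ 2)
    (f' := fun s => 2 * (1 * tanh s + s * (1 / cosh s ^ 2)) -
      K * (2 * tanh s * (1 / cosh s ^ 2))) h₀.le
    (fun s => (((hasDerivAt_id' s).mul (hd s)).const_mul 2).sub
      ((((hd s).pow 2).congr_deriv (by norm_num) :
        HasDerivAt (fun s => tanh s ^ 2) (2 * tanh s * (1 / cosh s ^ 2)) s).const_mul K))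
    ?_ ?_ hs
  · linarith
  · intro s hs hs'
    rw [hsign s hs]
    have := sinh_pos_iff.2 hs
    have := cosh_pos s
    exact mul_nonpos_of_nonneg_of_nonpos (by positivity) (by linarith [hmono s s₀ hs hs'.le])
  · intro s hs'
    have hs : 0 < s := h₀.trans hs'
    rw [hsign s hs]
    have := sinh_pos_iff.2 hs
    have := cosh_pos s
    exact mul_nonneg (by positivity) (by linarith [hmono s₀ s h₀ hs'.le])

/-- Hyperbolic parametrization of a pair of positive reals. -/
lemma sub_eq_add_mul_tanh {A B : ℝ} (hA : 0 < A) (hB : 0 < B) :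
    A - B = (A + B) * tanh ((log A - log B) / 2) := by
  have hx : ∀ {A : ℝ}, 0 < A → A = exp (log A / 2) ^ 2 := fun {A} h => by
    rw [← exp_nat_mul]; push_cast; rw [mul_div_cancel₀ _ two_ne_zero, exp_log h]
  rw [tanh_eq_sinh_div_cosh, sinh_eq, cosh_eq, neg_div', neg_sub, sub_div (log A),
    sub_div (log B), exp_sub, exp_sub]
  have h1 := exp_pos (log A / 2)
  have h2 := exp_pos (log B / 2)
  have e1 := hx hA
  have e2 := hx hB
  set p := exp (log A / 2)
  set q := exp (log B / 2)
  rw [e1, e2]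
  field_simp

/-- Hyperbolic parametrization of a pair of positive reals. -/
lemma two_mul_sqrt_mul_eq {A B : ℝ} (hA : 0 < A) (hB : 0 < B) :
    2 * √(A * B) = (A + B) * (1 / cosh ((log A - log B) / 2)) := by
  have hx : ∀ {A : ℝ}, 0 < A → A = exp (log A / 2) ^ 2 := fun {A} h => by
    rw [← exp_nat_mul]; push_cast; rw [mul_div_cancel₀ _ two_ne_zero, exp_log h]
  rw [cosh_eq, neg_div', neg_sub, sub_div (log A),
    sub_div (log B), exp_sub, exp_sub]
  have h1 := exp_pos (log A / 2)
  have h2 := exp_pos (log B / 2)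
  have e1 := hx hA
  have e2 := hx hB
  set p := exp (log A / 2)
  set q := exp (log B / 2)
  rw [e1, e2, ← mul_pow, sqrt_sq (by positivity)]
  field_simp

lemma sub_mul_log_sub_log_eq {A B : ℝ} (hA : 0 < A) (hB : 0 < B) :
    (A - B) * (log A - log B) = (A + B) *
      (2 * ((log A - log B) / 2) * tanh ((log A - log B) / 2)) := by
  rw [sub_eq_add_mul_tanh hA hB]
  ring

/-- The tangent line in `1 / cosh s`, multiplied by `A + B`, is affine in `A + B` and `√(A * B)`,
the two quantities whose sums over edges are controlled. -/
lemma spectral_pointwise {A B s₀ : ℝ} (hA : 0 < A) (hB : 0 < B) (h₀ : 0 < s₀) :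
    (A + B) * (2 * s₀ * tanh s₀ + (2 * cosh s₀ + 2 * s₀ / sinh s₀) * (1 / cosh s₀)) -
        2 * (2 * cosh s₀ + 2 * s₀ / sinh s₀) * √(A * B) ≤ (A - B) * (log A - log B) := by
  have h1 := tangent_inv_cosh h₀ ((log A - log B) / 2)
  have h2 := two_mul_sqrt_mul_eq hA hB
  rw [sub_mul_log_sub_log_eq hA hB]
  have h3 := mul_le_mul_of_nonneg_left h1 (by positivity : 0 ≤ A + B)
  refine le_trans (le_of_eq ?_) h3
  linear_combination (-(2 * cosh s₀ + 2 * s₀ / sinh s₀)) * h2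

/-- After the tangent line in `tanh² s`, the square `τ²` with `τ = tanh s` is linearized by `2 y τ δ
≤ τ² + y² δ²`, where `y = tanh s₀`. The result is linear in `(A - B) δ`, whose sum is an energy.
Here `δ` stands for the normalized increment of the length along an edge and `G` for the normalized
length of `g`. -/
lemma drift_pointwise {A B s₀ G δ : ℝ} (hA : 0 < A) (hB : 0 < B) (h₀ : 0 < s₀)
    (hδ : |δ| ≤ G) :
    (A + B) * (2 * s₀ * tanh s₀ -
        (cosh s₀ ^ 2 + s₀ * cosh s₀ / sinh s₀) * tanh s₀ ^ 2 * (1 + G ^ 2)) +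
      2 * (cosh s₀ ^ 2 + s₀ * cosh s₀ / sinh s₀) * tanh s₀ * ((A - B) * δ) ≤
    (A - B) * (log A - log B) := by
  have h1 := tangent_tanh_sq h₀ ((log A - log B) / 2)
  have h2 := sub_eq_add_mul_tanh hA hB
  rw [sub_mul_log_sub_log_eq hA hB]
  have hS := sinh_pos_iff.2 h₀
  have hC := cosh_pos s₀
  have hK : 0 ≤ cosh s₀ ^ 2 + s₀ * cosh s₀ / sinh s₀ := by positivity
  set K := cosh s₀ ^ 2 + s₀ * cosh s₀ / sinh s₀
  have hy : 0 ≤ tanh s₀ := by rw [tanh_eq_sinh_div_cosh]; positivity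
  set y := tanh s₀
  set τ := tanh ((log A - log B) / 2)
  have h3 := mul_le_mul_of_nonneg_left h1 (by positivity : 0 ≤ A + B)
  refine le_trans ?_ h3
  rw [h2]
  have h4 : 2 * y * (τ * δ) ≤ τ ^ 2 + y ^ 2 * G ^ 2 := by
    have : δ ^ 2 ≤ G ^ 2 := sq_le_sq' (abs_le.1 hδ).1 (abs_le.1 hδ).2
    nlinarith [sq_nonneg (τ - y * δ), mul_le_mul_of_nonneg_left this (sq_nonneg y)]
  have h5 := mul_le_mul_of_nonneg_left h4 (by positivity : 0 ≤ (A + B) * K)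
  nlinarith [h5]

end GroupWalk

noncomputable section

namespace GroupWalk

open ENNReal

/-! ### Expectations in the extended nonnegative reals -/

section Expectation

variable {α β : Type*}

/-- The expectation of a nonnegative function under a probability mass function. -/
def expect (p : PMF α) (F : α → ℝ≥0∞) : ℝ≥0∞ := ∑' x, p x * F x

/-- The restriction to positive mass is needed later: `negLog 0 = 0` by convention, so bounds on
`negLog` hold only on the support. -/
lemma expect_mono {p : PMF α} {F G : α → ℝ≥0∞} (h : ∀ x, p x ≠ 0 → F x ≤ G x) :
    expect p F ≤ expect p G := by
  refine ENNReal.tsum_le_tsum fun x => ?_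
  by_cases hx : p x = 0
  · simp [hx]
  · gcongr
    exact h x hx

lemma expect_add (p : PMF α) (F G : α → ℝ≥0∞) :
    expect p (fun x => F x + G x) = expect p F + expect p G := by
  simp only [expect, mul_add, ENNReal.tsum_add]

lemma expect_const (p : PMF α) (c : ℝ≥0∞) : expect p (fun _ => c) = c := by
  simp [expect, ENNReal.tsum_mul_right, p.tsum_coe]

lemma expect_bind (p : PMF α) (q : α → PMF β) (F : β → ℝ≥0∞) :
    expect (p.bind q) F = expect p fun a => expect (q a) F := by
  simp only [expect, PMF.bind_apply, ← ENNReal.tsum_mul_right, ← ENNReal.tsum_mul_left]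
  rw [ENNReal.tsum_comm]
  simp only [mul_assoc]

lemma expect_pure (a : α) (F : α → ℝ≥0∞) : expect (PMF.pure a) F = F a := by
  rw [expect, tsum_eq_single a]
  · simp
  · intro b hb
    simp [hb]

lemma expect_map (p : PMF α) (f : α → β) (F : β → ℝ≥0∞) :
    expect (p.map f) F = expect p fun a => F (f a) := by
  rw [← PMF.bind_pure_comp, expect_bind]
  simp only [Function.comp, expect_pure]

lemma expect_expect (p : PMF α) (q : PMF β) (F : α → β → ℝ≥0∞) :
    expect p (fun x => expect q (F x)) = ∑' z : α × β, p z.1 * q z.2 * F z.1 z.2 := by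
  rw [ENNReal.tsum_prod']
  simp only [expect, ← ENNReal.tsum_mul_left, mul_assoc]

lemma toReal_mul_ofReal (p : PMF α) {f : α → ℝ} (hf : ∀ x, 0 ≤ f x) (x : α) :
    (p x * ENNReal.ofReal (f x)).toReal = f x * (p x).toReal := by
  rw [ENNReal.toReal_mul, ENNReal.toReal_ofReal (hf x), mul_comm]

lemma summable_iff_expect (p : PMF α) {f : α → ℝ} (hf : ∀ x, 0 ≤ f x) :
    (Summable fun x => f x * (p x).toReal) ↔ expect p (fun x => ENNReal.ofReal (f x)) ≠ ⊤ := by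
  simp only [← toReal_mul_ofReal p hf]
  refine ⟨fun h => ?_, ENNReal.summable_toReal⟩
  have h' := h.tsum_ofReal_ne_top
  simp only [ENNReal.ofReal_toReal
    (ENNReal.mul_ne_top (p.apply_ne_top _) (ofReal_ne_top))] at h'
  exact h'

lemma tsum_eq_toReal_expect (p : PMF α) {f : α → ℝ} (hf : ∀ x, 0 ≤ f x) :
    ∑' x, f x * (p x).toReal = (expect p fun x => ENNReal.ofReal (f x)).toReal := by
  simp only [← toReal_mul_ofReal p hf]
  rw [expect, ENNReal.tsum_toReal_eq fun x =>
    ENNReal.mul_ne_top (p.apply_ne_top x) ofReal_ne_top]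

lemma hasSum_prod_of_expect (p : PMF α) (q : PMF β) {f : α → β → ℝ} (hf : ∀ x y, 0 ≤ f x y)
    (h : expect p (fun x => expect q fun y => ENNReal.ofReal (f x y)) ≠ ⊤) :
    HasSum (fun z : α × β => (p z.1).toReal * (q z.2).toReal * f z.1 z.2)
      (expect p (fun x => expect q fun y => ENNReal.ofReal (f x y))).toReal := by
  rw [expect_expect] at h ⊢
  have e : ∀ z : α × β, (p z.1).toReal * (q z.2).toReal * f z.1 z.2 =
      (p z.1 * q z.2 * ENNReal.ofReal (f z.1 z.2)).toReal := fun z => by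
    rw [ENNReal.toReal_mul, ENNReal.toReal_mul, ENNReal.toReal_ofReal (hf _ _)]
  simp only [e]
  rw [ENNReal.tsum_toReal_eq fun z => ENNReal.ne_top_of_tsum_ne_top h z]
  exact ENNReal.hasSum_toReal h

end Expectation

/-! ### Entropy of mixtures -/

section Entropy

variable {α : Type*}

/-- The nonnegative function `-log c` of a weight `c ≤ 1`. -/
def negLog (c : ℝ≥0∞) : ℝ≥0∞ := ENNReal.ofReal (-Real.log c.toReal)

lemma neg_log_nonneg (p : PMF α) (x : α) : 0 ≤ -Real.log (p x).toReal := by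
  have h : (p x).toReal ≤ 1 :=
    ENNReal.toReal_le_of_le_ofReal zero_le_one (by simpa using p.coe_le_one x)
  linarith [Real.log_nonpos ENNReal.toReal_nonneg h]

lemma negLog_le_add {a b c : ℝ≥0∞} (ha : a ≠ 0) (hb : b ≠ 0) (ha1 : a ≤ 1) (hb1 : b ≤ 1)
    (hc : c ≠ ⊤) (h : a * b ≤ c) : negLog c ≤ negLog a + negLog b := by
  have ha' : 0 < a.toReal := ENNReal.toReal_pos ha (ha1.trans_lt one_lt_top).ne
  have hb' : 0 < b.toReal := ENNReal.toReal_pos hb (hb1.trans_lt one_lt_top).ne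
  have ha2 : a.toReal ≤ 1 := by simpa using ENNReal.toReal_mono one_ne_top ha1
  have hb2 : b.toReal ≤ 1 := by simpa using ENNReal.toReal_mono one_ne_top hb1
  have h' : a.toReal * b.toReal ≤ c.toReal := by
    rw [← ENNReal.toReal_mul]; exact ENNReal.toReal_mono hc h
  rw [negLog, negLog, negLog, ← ENNReal.ofReal_add
    (by linarith [Real.log_nonpos ha'.le ha2]) (by linarith [Real.log_nonpos hb'.le hb2])]
  refine ENNReal.ofReal_le_ofReal ?_
  have := Real.log_le_log (by positivity) h'
  rw [Real.log_mul ha'.ne' hb'.ne'] at this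
  linarith

/-- The entropy as an extended nonnegative real. -/
def entropyENN (p : PMF α) : ℝ≥0∞ := expect p fun x => negLog (p x)

lemma finiteEntropy_iff (p : PMF α) : FiniteEntropy p ↔ entropyENN p ≠ ⊤ := by
  have := summable_iff_expect p (neg_log_nonneg p)
  rw [entropyENN]
  simp only [negLog]
  rw [← this, FiniteEntropy]
  simp only [neg_mul, mul_comm (Real.log _)]

lemma entropy_eq (p : PMF α) : entropy p = (entropyENN p).toReal := by
  have := tsum_eq_toReal_expect p (neg_log_nonneg p)
  rw [entropyENN]
  simp only [negLog]
  rw [← this, entropy]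
  simp only [neg_mul, mul_comm (Real.log _)]

lemma entropy_nonneg (p : PMF α) : 0 ≤ entropy p := by
  rw [entropy_eq]; exact ENNReal.toReal_nonneg

/-- The entropy of a mixture is at most the mean entropy plus the entropy of the weights. -/
lemma entropyENN_bind_le {β : Type*} (p : PMF β) (q : β → PMF α) :
    entropyENN (p.bind q) ≤ expect p fun b => negLog (p b) + entropyENN (q b) := by
  rw [entropyENN, expect_bind]
  refine expect_mono fun b hb => ?_
  rw [← expect_const (q b) (negLog (p b)), entropyENN, ← expect_add]
  refine expect_mono fun x hx => ?_
  refine negLog_le_add hb hx (p.coe_le_one b) ((q b).coe_le_one x) ((p.bind q).apply_ne_top x) ?_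
  rw [PMF.bind_apply]
  exact ENNReal.le_tsum b

end Entropy

/-! ### Convolution powers and the asymptotic entropy -/

section Convolution

variable {Γ : Type*} [Group Γ]

lemma expect_conv (p q : PMF Γ) (F : Γ → ℝ≥0∞) :
    expect (conv p q) F = expect p fun x => expect q fun y => F (x * y) := by
  simp only [conv, expect_bind, expect_map]

lemma mul_le_conv (p q : PMF Γ) (x y : Γ) : p x * q y ≤ conv p q (x * y) := by
  rw [conv, PMF.bind_apply]
  refine le_trans ?_ (ENNReal.le_tsum x)
  gcongr
  rw [PMF.map_apply]
  refine le_trans ?_ (ENNReal.le_tsum y)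
  simp

lemma conv_apply (p q : PMF Γ) (z : Γ) : conv p q z = ∑' x, p x * q (x⁻¹ * z) := by
  rw [conv, PMF.bind_apply]
  refine tsum_congr fun x => ?_
  rw [PMF.map_apply, tsum_eq_single (x⁻¹ * z)]
  · simp
  · intro b hb
    rw [if_neg]
    rintro rfl
    simp at hb

lemma conv_assoc (p q r : PMF Γ) : conv (conv p q) r = conv p (conv q r) := by
  simp only [conv, PMF.bind_bind, PMF.bind_map, PMF.map_bind, PMF.map_comp]
  congr! 4 with a b
  simp only [Function.comp_def, mul_assoc]

lemma conv_pure_one (p : PMF Γ) : conv p (PMF.pure 1) = p := by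
  simp [conv, PMF.pure_map]

lemma pure_one_conv (p : PMF Γ) : conv (PMF.pure 1) p = p := by
  simp only [conv, PMF.pure_bind, one_mul]
  exact PMF.map_id p

lemma convPow_add (μ : PMF Γ) (m n : ℕ) :
    convPow μ (m + n) = conv (convPow μ m) (convPow μ n) := by
  induction n with
  | zero => exact (conv_pure_one _).symm
  | succ n ih => rw [← add_assoc, convPow, convPow, ih, conv_assoc]

lemma convPow_one (μ : PMF Γ) : convPow μ 1 = μ := pure_one_conv μ

lemma IsSymmetric.convPow {μ : PMF Γ} (hμ : IsSymmetric μ) (n : ℕ) :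
    IsSymmetric (convPow μ n) := by
  induction n with
  | zero =>
    intro g
    by_cases h : g = 1 <;> simp [GroupWalk.convPow, PMF.pure_apply, h]
  | succ n ih =>
    intro g
    have e : GroupWalk.convPow μ (n + 1) = conv μ (GroupWalk.convPow μ n) := by
      rw [add_comm, convPow_add, convPow_one]
    rw [e, conv_apply, ← e, GroupWalk.convPow, conv_apply,
      ← (Equiv.mulLeft g⁻¹).tsum_eq]
    refine tsum_congr fun x => ?_
    rw [mul_comm, Equiv.coe_mulLeft, ← ih, ← hμ]
    congr 2 <;> group

/-- The pointwise bound `p x * q y ≤ conv p q (x * y)` suffices: `-log` reverses it, and averaging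
over independent `x` and `y` gives the two entropies. -/
lemma entropyENN_conv_le (p q : PMF Γ) :
    entropyENN (conv p q) ≤ entropyENN p + entropyENN q := by
  rw [entropyENN, expect_conv, ← expect_const p (entropyENN q), entropyENN, ← expect_add]
  refine expect_mono fun x hx => ?_
  rw [← expect_const q (negLog (p x)), entropyENN, ← expect_add]
  refine expect_mono fun y hy => ?_
  exact negLog_le_add hx hy (p.coe_le_one x) (q.coe_le_one y) (PMF.apply_ne_top _ _)
    (mul_le_conv p q x y)

lemma entropyENN_pure {α : Type*} (g : α) : entropyENN (PMF.pure g) = 0 := by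
  simp [entropyENN, expect_pure, negLog]

lemma entropyENN_convPow_ne_top {μ : PMF Γ} (h : FiniteEntropy μ) (n : ℕ) :
    entropyENN (convPow μ n) ≠ ⊤ := by
  induction n with
  | zero => simp [convPow, entropyENN_pure]
  | succ n ih =>
    exact ne_top_of_le_ne_top (ENNReal.add_ne_top.2 ⟨ih, (finiteEntropy_iff μ).1 h⟩)
      (entropyENN_conv_le _ _)

lemma subadditive_entropy {μ : PMF Γ} (h : FiniteEntropy μ) :
    Subadditive fun n => entropy (convPow μ n) := by
  intro m n
  simp only [entropy_eq]
  have hm := entropyENN_convPow_ne_top h m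
  have hn := entropyENN_convPow_ne_top h n
  rw [← ENNReal.toReal_add hm hn, convPow_add]
  exact ENNReal.toReal_mono (ENNReal.add_ne_top.2 ⟨hm, hn⟩) (entropyENN_conv_le _ _)

lemma bddBelow_div_of_nonneg {u : ℕ → ℝ} (h : ∀ n, 0 ≤ u n) :
    BddBelow (Set.range fun n => u n / n) := by
  refine ⟨0, ?_⟩
  rintro _ ⟨n, rfl⟩
  exact div_nonneg (h n) n.cast_nonneg

/-- Fekete's lemma gives convergence, so the `limUnder` in the definition is a genuine limit. -/
lemma tendsto_entropy {μ : PMF Γ} (h : FiniteEntropy μ) :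
    Filter.Tendsto (fun n : ℕ => entropy (convPow μ n) / n) Filter.atTop
      (nhds (asymptoticEntropy μ)) :=
  tendsto_nhds_limUnder ⟨_, (subadditive_entropy h).tendsto_lim
    (bddBelow_div_of_nonneg fun _ => entropy_nonneg _)⟩

lemma asymptoticEntropy_nonneg {μ : PMF Γ} (h : FiniteEntropy μ) : 0 ≤ asymptoticEntropy μ :=
  ge_of_tendsto' (tendsto_entropy h) fun n => div_nonneg (entropy_nonneg _) n.cast_nonneg

/-- The entropies grow at most like an affine function with slope close to `h`. -/
lemma exists_entropy_le {μ : PMF Γ} (h : FiniteEntropy μ) {b : ℝ} (hb : asymptoticEntropy μ < b) :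
    ∃ C : ℝ, 0 ≤ C ∧ ∀ n : ℕ, entropy (convPow μ n) ≤ C + b * n := by
  have hb0 : 0 < b := (asymptoticEntropy_nonneg h).trans_lt hb
  obtain ⟨N, hN⟩ := Filter.eventually_atTop.1 ((tendsto_entropy h).eventually_lt_const hb)
  -- The constant absorbs the finitely many initial entropies. The range up to `N` includes `n = 0`,
  -- where the quotient carries no information.
  refine ⟨∑ n ∈ Finset.range (N + 1), entropy (convPow μ n),
    Finset.sum_nonneg fun _ _ => entropy_nonneg _, fun n => ?_⟩
  rcases lt_or_ge n (N + 1) with hn | hn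
  · have := Finset.single_le_sum (f := fun n => entropy (convPow μ n))
      (fun _ _ => entropy_nonneg _) (Finset.mem_range.2 hn)
    have : 0 ≤ b * n := by positivity
    linarith
  · have h1 := hN n (by omega)
    have hn0 : (0 : ℝ) < n := by exact_mod_cast (by omega : 0 < n)
    rw [div_lt_iff₀ hn0] at h1
    have := Finset.sum_nonneg fun n (_ : n ∈ Finset.range (N + 1)) =>
      entropy_nonneg (convPow μ n)
    linarith

end Convolution

end GroupWalk

end

noncomputable section

namespace GroupWalk

/-! ### The `ℓ²` norm of the Markov operator and the spectral radius -/

section Spectral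

variable {Γ : Type*} [Group Γ] {μ : PMF Γ}

lemma toReal_apply_le_one {α : Type*} (p : PMF α) (x : α) : (p x).toReal ≤ 1 := by
  simpa using ENNReal.toReal_mono ENNReal.one_ne_top (p.coe_le_one x)

/-- Symmetry makes the Markov operator `P` self-adjoint: this is `⟨P^m δ_x, P^n δ_y⟩ = ⟨δ_x, P^{m+n}
δ_y⟩`. -/
lemma hasSum_convPow_mul (hμ : IsSymmetric μ) (m n : ℕ) (x y : Γ) :
    HasSum (fun z => (convPow μ m (x⁻¹ * z)).toReal * (convPow μ n (y⁻¹ * z)).toReal)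
      (convPow μ (m + n) (x⁻¹ * y)).toReal := by
  have e : convPow μ (m + n) (x⁻¹ * y) =
      ∑' z, convPow μ m (x⁻¹ * z) * convPow μ n (y⁻¹ * z) := by
    rw [convPow_add, conv_apply, ← (Equiv.mulLeft x⁻¹).tsum_eq]
    refine tsum_congr fun z => ?_
    rw [Equiv.coe_mulLeft, ← (hμ.convPow n) (y⁻¹ * z)]
    congr 2
    group
  have ht : ∑' z, convPow μ m (x⁻¹ * z) * convPow μ n (y⁻¹ * z) ≠ ⊤ := by
    rw [← e]; exact PMF.apply_ne_top _ _
  simp only [← ENNReal.toReal_mul]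
  rw [e, ENNReal.tsum_toReal_eq fun z => ENNReal.ne_top_of_tsum_ne_top ht z]
  exact ENNReal.hasSum_toReal ht

/-- Expand `‖Pⁿ δ_e - Pⁿ δ_g‖² ≥ 0`; by left invariance both diagonal terms are the return
probability. -/
lemma convPow_even_le (hμ : IsSymmetric μ) (n : ℕ) (g : Γ) :
    (convPow μ (n + n) g).toReal ≤ (convPow μ (n + n) 1).toReal := by
  have h1 := hasSum_convPow_mul hμ n n 1 1
  have h2 := hasSum_convPow_mul hμ n n g g
  have h3 := hasSum_convPow_mul hμ n n 1 g
  have h := ((h1.add h2).sub (h3.mul_left 2)).nonneg fun z => by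
    nlinarith [sq_nonneg ((convPow μ n (1⁻¹ * z)).toReal - (convPow μ n (g⁻¹ * z)).toReal)]
  simp only [inv_one, one_mul, inv_mul_cancel] at h
  linarith

/-- The quadratic form `⟨f, Pⁿ f⟩` of the walk, for `f` supported in the finite set `S`. -/
def quadForm (μ : PMF Γ) (S : Finset Γ) (f : Γ → ℝ) (n : ℕ) : ℝ :=
  ∑ x ∈ S, ∑ y ∈ S, f x * f y * (convPow μ n (x⁻¹ * y)).toReal

lemma hasSum_quadForm (hμ : IsSymmetric μ) (S : Finset Γ) (f : Γ → ℝ) (m n : ℕ) :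
    HasSum (fun z => (∑ x ∈ S, f x * (convPow μ m (x⁻¹ * z)).toReal) *
      ∑ y ∈ S, f y * (convPow μ n (y⁻¹ * z)).toReal) (quadForm μ S f (m + n)) := by
  simp only [Finset.sum_mul_sum]
  refine hasSum_sum fun x _ => hasSum_sum fun y _ => ?_
  have h := (hasSum_convPow_mul hμ m n x y).mul_left (f x * f y)
  simp only [mul_mul_mul_comm (f x) (f y)] at h
  exact h

lemma quadForm_even_nonneg (hμ : IsSymmetric μ) (S : Finset Γ) (f : Γ → ℝ) (n : ℕ) :
    0 ≤ quadForm μ S f (n + n) :=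
  (hasSum_quadForm hμ S f n n).nonneg fun _ => mul_self_nonneg _

/-- Cauchy–Schwarz for `P^m f` and `P^n f`, read off from the discriminant of `t ↦ ‖t P^m f - P^n
f‖²`. -/
lemma quadForm_sq_le (hμ : IsSymmetric μ) (S : Finset Γ) (f : Γ → ℝ) (m n : ℕ) :
    quadForm μ S f (m + n) ^ 2 ≤ quadForm μ S f (m + m) * quadForm μ S f (n + n) := by
  have h1 := hasSum_quadForm hμ S f m m
  have h2 := hasSum_quadForm hμ S f n n
  have h3 := hasSum_quadForm hμ S f m n
  have h := discrim_le_zero (a := quadForm μ S f (m + m)) (b := -2 * quadForm μ S f (m + n))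
    (c := quadForm μ S f (n + n)) fun t => by
      have h4 := (((h1.mul_left (t * t)).add (h3.mul_left (-2 * t))).add h2).nonneg fun z => by
        nlinarith [sq_nonneg (t * (∑ x ∈ S, f x * (convPow μ m (x⁻¹ * z)).toReal) -
          ∑ y ∈ S, f y * (convPow μ n (y⁻¹ * z)).toReal)]
      linarith
  rw [discrim] at h
  nlinarith

lemma quadForm_zero (S : Finset Γ) (f : Γ → ℝ) : quadForm μ S f 0 = ∑ x ∈ S, f x ^ 2 := by
  classical
  refine Finset.sum_congr rfl fun x hx => ?_
  rw [Finset.sum_eq_single x]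
  · simp [convPow, sq]
  · intro y _ hy
    rw [convPow, PMF.pure_apply_of_ne]
    · simp
    · rwa [Ne, inv_mul_eq_one, eq_comm]
  · exact fun h => absurd hx h

lemma quadForm_even_le (hμ : IsSymmetric μ) (S : Finset Γ) {f : Γ → ℝ} (hf : ∀ x, 0 ≤ f x)
    (n : ℕ) :
    quadForm μ S f (n + n) ≤ (∑ x ∈ S, f x) ^ 2 * (convPow μ (n + n) 1).toReal := by
  rw [sq, Finset.sum_mul_sum, Finset.sum_mul]
  refine Finset.sum_le_sum fun x _ => ?_
  rw [Finset.sum_mul]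
  refine Finset.sum_le_sum fun y _ => ?_
  exact mul_le_mul_of_nonneg_left (convPow_even_le hμ n _) (mul_nonneg (hf x) (hf y))

lemma rpow_return_le_one (μ : PMF Γ) (n : ℕ) :
    (convPow μ n 1).toReal ^ (1 / (n : ℝ)) ≤ 1 :=
  Real.rpow_le_one ENNReal.toReal_nonneg (toReal_apply_le_one _ _) (by positivity)

lemma isBoundedUnder_return (μ : PMF Γ) : Filter.IsBoundedUnder (· ≤ ·) Filter.atTop
    fun n : ℕ => (convPow μ n 1).toReal ^ (1 / (n : ℝ)) :=
  Filter.isBoundedUnder_of ⟨1, rpow_return_le_one μ⟩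

lemma isCoboundedUnder_return (μ : PMF Γ) : Filter.IsCoboundedUnder (· ≤ ·) Filter.atTop
    fun n : ℕ => (convPow μ n 1).toReal ^ (1 / (n : ℝ)) :=
  Filter.IsBoundedUnder.isCoboundedUnder_le
    (Filter.isBoundedUnder_of ⟨0, fun _ => Real.rpow_nonneg ENNReal.toReal_nonneg _⟩)

lemma spectralRad_le_one (μ : PMF Γ) : spectralRad μ ≤ 1 :=
  Filter.limsup_le_of_le (isCoboundedUnder_return μ)
    (Filter.Eventually.of_forall (rpow_return_le_one μ))

lemma spectralRad_nonneg (μ : PMF Γ) : 0 ≤ spectralRad μ :=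
  Filter.le_limsup_of_frequently_le
    (Filter.Frequently.of_forall fun _ => Real.rpow_nonneg ENNReal.toReal_nonneg _)
    (isBoundedUnder_return μ)

lemma eventually_return_le {t : ℝ} (ht : spectralRad μ < t) :
    ∀ᶠ n : ℕ in Filter.atTop, (convPow μ n 1).toReal ≤ t ^ n := by
  filter_upwards [Filter.eventually_lt_of_limsup_lt ht (isBoundedUnder_return μ),
    Filter.eventually_gt_atTop 0] with n hn h0
  have h1 : ((convPow μ n 1).toReal ^ (1 / (n : ℝ))) ^ n = (convPow μ n 1).toReal := by
    rw [one_div, Real.rpow_inv_natCast_pow ENNReal.toReal_nonneg h0.ne']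
  rw [← h1]
  exact pow_le_pow_left₀ (Real.rpow_nonneg ENNReal.toReal_nonneg _) hn.le n

/-- The `ℓ²` operator norm of `P²` is at most `ρ²`. -/
lemma quadForm_two_le (hμ : IsSymmetric μ) (S : Finset Γ) {f : Γ → ℝ} (hf : ∀ x, 0 ≤ f x) :
    quadForm μ S f 2 ≤ spectralRad μ ^ 2 * quadForm μ S f 0 := by
  by_contra! hlt
  -- By Cauchy–Schwarz `b` is log-convex, so its successive ratios are at least `r = b 1 / b 0` and
  -- `b n ≥ rⁿ b 0`. But `b n` is at most a constant times the return probability at time `2n`, so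
  -- `r > ρ²` is impossible.
  set b : ℕ → ℝ := fun n => quadForm μ S f (n + n) with hb
  have hb0 : 0 ≤ b 0 := quadForm_even_nonneg hμ S f 0
  have hlt' : spectralRad μ ^ 2 * b 0 < b 1 := hlt
  have hb1 : 0 < b 1 := lt_of_le_of_lt (by positivity) hlt'
  have hconv : ∀ n, b (n + 1) ^ 2 ≤ b n * b (n + 2) := fun n => by
    have := quadForm_sq_le hμ S f n (n + 2)
    rwa [show n + (n + 2) = n + 1 + (n + 1) by ring] at this
  have hb0' : 0 < b 0 := hb0.lt_of_ne fun h => by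
    have := hconv 0
    rw [← h, zero_mul] at this
    exact absurd this (not_le.2 (pow_pos hb1 2))
  set r := b 1 / b 0 with hr
  have hr0 : 0 < r := div_pos hb1 hb0'
  have hstep : ∀ n, 0 < b n ∧ r * b n ≤ b (n + 1) := fun n => by
    induction n with
    | zero => exact ⟨hb0', by rw [hr, div_mul_cancel₀ _ hb0'.ne']⟩
    | succ n ih =>
      have hp : 0 < b (n + 1) := (mul_pos hr0 ih.1).trans_le ih.2
      refine ⟨hp, ?_⟩
      have h1 := hconv n
      have h2 := mul_le_mul_of_nonneg_right ih.2 hp.le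
      refine le_of_mul_le_mul_left ?_ ih.1
      calc b n * (r * b (n + 1)) = r * b n * b (n + 1) := by ring
        _ ≤ b (n + 1) * b (n + 1) := h2
        _ = b (n + 1) ^ 2 := by ring
        _ ≤ _ := h1
  have hpow : ∀ n, r ^ n * b 0 ≤ b n := fun n => by
    induction n with
    | zero => simp
    | succ n ih =>
      calc r ^ (n + 1) * b 0 = r * (r ^ n * b 0) := by ring
        _ ≤ r * b n := by gcongr
        _ ≤ _ := (hstep n).2
  have hρr : spectralRad μ ^ 2 < r := by rwa [hr, lt_div_iff₀ hb0']
  obtain ⟨t, ht, ht'⟩ := exists_between (Real.lt_sqrt (spectralRad_nonneg μ) |>.2 hρr)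
  have ht0 : 0 < t := (spectralRad_nonneg μ).trans_lt ht
  have htr : t ^ 2 < r := (Real.lt_sqrt ht0.le).1 ht'
  have h1 : 1 < r / t ^ 2 := by rwa [one_lt_div (by positivity)]
  have hC : 0 ≤ (∑ x ∈ S, f x) ^ 2 := sq_nonneg _
  set C := (∑ x ∈ S, f x) ^ 2
  have hev : ∀ᶠ n : ℕ in Filter.atTop, (r / t ^ 2) ^ n ≤ C / b 0 := by
    have htend : Filter.Tendsto (fun n : ℕ => n + n) Filter.atTop Filter.atTop :=
      Filter.tendsto_atTop_mono (fun n => n.le_add_left n) Filter.tendsto_id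
    filter_upwards [htend.eventually (eventually_return_le ht)] with n hn
    rw [div_pow, div_le_div_iff₀ (by positivity) hb0']
    calc r ^ n * b 0 ≤ b n := hpow n
      _ ≤ C * (convPow μ (n + n) 1).toReal := quadForm_even_le hμ S hf n
      _ ≤ C * t ^ (n + n) := by gcongr
      _ = C * (t ^ 2) ^ n := by rw [← pow_mul]; ring_nf
  obtain ⟨n, hn, hn'⟩ :=
    (hev.and ((tendsto_pow_atTop_atTop_of_one_lt h1).eventually_gt_atTop (C / b 0))).exists
  exact absurd hn (not_le.2 hn')

/-- The `ℓ²` operator norm of the Markov operator is at most `ρ`. -/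
lemma quadForm_one_le (hμ : IsSymmetric μ) (S : Finset Γ) {f : Γ → ℝ} (hf : ∀ x, 0 ≤ f x) :
    quadForm μ S f 1 ≤ spectralRad μ * quadForm μ S f 0 := by
  have h1 := quadForm_sq_le hμ S f 0 1
  have h2 := quadForm_two_le hμ S hf
  have h0 : 0 ≤ quadForm μ S f 0 := quadForm_even_nonneg hμ S f 0
  refine le_of_sq_le_sq ?_ (mul_nonneg (spectralRad_nonneg μ) h0)
  calc quadForm μ S f 1 ^ 2 ≤ quadForm μ S f 0 * quadForm μ S f 2 := h1
    _ ≤ quadForm μ S f 0 * (spectralRad μ ^ 2 * quadForm μ S f 0) := by gcongr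
    _ = _ := by ring

/-- Testing the bound on `δ_e` gives `ρ² ≥ μ^{*2}(e) ≥ μ(g) μ(g⁻¹) = μ(g)²`, which is positive for
`g` in the support. -/
lemma spectralRad_pos (hμ : IsSymmetric μ) : 0 < spectralRad μ := by
  have h := quadForm_two_le hμ {1} (f := fun _ => 1) fun _ => zero_le_one
  simp only [quadForm, Finset.sum_singleton, mul_one, one_mul, inv_one, convPow,
    PMF.pure_apply_self, ENNReal.toReal_one] at h
  obtain ⟨g, hg⟩ := μ.support_nonempty
  have h1 := mul_le_conv μ μ g g⁻¹
  rw [mul_inv_cancel, hμ] at h1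
  have h2 := ENNReal.toReal_mono (PMF.apply_ne_top _ _) h1
  rw [ENNReal.toReal_mul] at h2
  have h3 : 0 < (μ g).toReal := ENNReal.toReal_pos hg (μ.apply_ne_top g)
  rw [pure_one_conv] at h
  have : 0 < spectralRad μ ^ 2 := by nlinarith
  exact (spectralRad_nonneg μ).lt_of_ne fun h => by simp [← h] at this

/-- For a probability measure `ν`, the function `√ν` is a unit vector of `ℓ²`, so its energy is
at most `ρ`. -/
lemma sum_sqrt_le (hμ : IsSymmetric μ) (ν : PMF Γ) (s : Finset (Γ × Γ)) :
    ∑ z ∈ s, (μ z.2).toReal * √((ν z.1).toReal * (ν (z.1 * z.2)).toReal) ≤ spectralRad μ := by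
  classical
  -- `S` contains both endpoints of every edge in `s`, so the sum over `s` is part of the quadratic
  -- form of `√ν` restricted to `S`.
  set S : Finset Γ := s.image (fun z => z.1) ∪ s.image fun z => z.1 * z.2 with hS
  set f : Γ → ℝ := fun x => √(ν x).toReal with hf
  have hf0 : ∀ x, 0 ≤ f x := fun x => Real.sqrt_nonneg _
  have h1 := quadForm_one_le hμ S hf0
  have h0 : quadForm μ S f 0 ≤ 1 := by
    rw [quadForm_zero]
    have e : ∑ x ∈ S, f x ^ 2 = ∑ x ∈ S, (ν x).toReal :=
      Finset.sum_congr rfl fun x _ => Real.sq_sqrt ENNReal.toReal_nonneg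
    rw [e, ← ENNReal.toReal_sum fun x _ => ν.apply_ne_top x]
    have := ENNReal.toReal_mono ENNReal.one_ne_top ((ENNReal.sum_le_tsum S).trans_eq ν.tsum_coe)
    simpa using this
  have h2 : ∑ z ∈ s, (μ z.2).toReal * √((ν z.1).toReal * (ν (z.1 * z.2)).toReal) ≤
      quadForm μ S f 1 := by
    rw [quadForm, ← Finset.sum_product']
    have hinj : Set.InjOn (fun z : Γ × Γ => (z.1, z.1 * z.2)) s := by
      rintro ⟨a, b⟩ _ ⟨c, d⟩ _ h
      simp only [Prod.mk.injEq] at h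
      obtain ⟨rfl, h⟩ := h
      rw [mul_right_inj] at h
      rw [h]
    have hsub : s.image (fun z : Γ × Γ => (z.1, z.1 * z.2)) ⊆ S ×ˢ S := by
      intro w hw
      obtain ⟨z, hz, rfl⟩ := Finset.mem_image.1 hw
      exact Finset.mem_product.2
        ⟨Finset.mem_union_left _ (Finset.mem_image.2 ⟨z, hz, rfl⟩),
          Finset.mem_union_right _ (Finset.mem_image.2 ⟨z, hz, rfl⟩)⟩
    refine le_trans (le_of_eq ?_) (Finset.sum_le_sum_of_subset_of_nonneg hsub fun w _ _ =>
      mul_nonneg (mul_nonneg (hf0 _) (hf0 _)) ENNReal.toReal_nonneg)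
    rw [Finset.sum_image hinj]
    refine Finset.sum_congr rfl fun z _ => ?_
    simp only [convPow_one, inv_mul_cancel_left, hf]
    rw [Real.sqrt_mul ENNReal.toReal_nonneg, mul_comm]
  calc _ ≤ quadForm μ S f 1 := h2
    _ ≤ spectralRad μ * quadForm μ S f 0 := h1
    _ ≤ spectralRad μ * 1 := by gcongr; exact spectralRad_nonneg μ
    _ = _ := mul_one _

end Spectral

end GroupWalk

end

noncomputable section

namespace GroupWalk

open ENNReal

/-! ### The geometric distribution -/

section Geometric

variable {a : ℝ}

lemma hasSum_geom (h0 : 0 ≤ a) (h1 : a < 1) : HasSum (fun n : ℕ => (1 - a) * a ^ n) 1 := by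
  have := (hasSum_geometric_of_lt_one h0 h1).mul_left (1 - a)
  rwa [mul_inv_cancel₀ (by linarith)] at this

/-- The geometric distribution `n ↦ (1 - a) aⁿ`. -/
def geom (a : ℝ) (h0 : 0 ≤ a) (h1 : a < 1) : PMF ℕ :=
  ⟨fun n => ENNReal.ofReal ((1 - a) * a ^ n), by
    refine ENNReal.summable.hasSum_iff.2 ?_
    have h := hasSum_geom h0 h1
    rw [← ENNReal.ofReal_tsum_of_nonneg
      (fun n => mul_nonneg (by linarith) (pow_nonneg h0 n)) h.summable, h.tsum_eq, ofReal_one]⟩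

lemma geom_apply (h0 : 0 ≤ a) (h1 : a < 1) (n : ℕ) :
    geom a h0 h1 n = ENNReal.ofReal ((1 - a) * a ^ n) := rfl

lemma geom_succ (h0 : 0 ≤ a) (h1 : a < 1) (n : ℕ) :
    geom a h0 h1 (n + 1) = ENNReal.ofReal a * geom a h0 h1 n := by
  rw [geom_apply, geom_apply, ← ENNReal.ofReal_mul h0]
  congr 1
  ring

lemma expect_geom_affine (h0 : 0 ≤ a) (h1 : a < 1) {α β : ℝ} (hα : 0 ≤ α) (hβ : 0 ≤ β) :
    expect (geom a h0 h1) (fun n => ENNReal.ofReal (α + β * n)) =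
      ENNReal.ofReal (α + β * (a / (1 - a))) := by
  have h1a : 0 < 1 - a := by linarith
  have hs : HasSum (fun n : ℕ => (1 - a) * a ^ n * (α + β * n)) (α + β * (a / (1 - a))) := by
    have e1 := (hasSum_geom h0 h1).mul_left α
    have e2 := (hasSum_coe_mul_geometric_of_norm_lt_one
      (r := a) (by rwa [Real.norm_eq_abs, abs_of_nonneg h0])).mul_left (β * (1 - a))
    convert e1.add e2 using 1
    · rfl
    · funext n; ring
    · field_simp
  have hnn : ∀ n : ℕ, 0 ≤ (1 - a) * a ^ n * (α + β * n) := fun n => by positivity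
  rw [expect, ← hs.tsum_eq, ENNReal.ofReal_tsum_of_nonneg hnn hs.summable]
  refine tsum_congr fun n => ?_
  rw [geom_apply, ← ENNReal.ofReal_mul (by positivity)]

end Geometric

/-! ### Green measures, energy and entropy production -/

section Green

variable {Γ : Type*} [Group Γ] {μ : PMF Γ} {a : ℝ} {h0 : 0 ≤ a} {h1 : a < 1}

/-- The normalized Green measure `∑ (1 - a) aⁿ μ^{*n}`. -/
def green (μ : PMF Γ) (a : ℝ) (h0 : 0 ≤ a) (h1 : a < 1) : PMF Γ :=
  (geom a h0 h1).bind (convPow μ)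

/-- The resolvent identity `ν = (1 - a) δ_e + a ν * μ`. -/
lemma expect_green (F : Γ → ℝ≥0∞) :
    expect (green μ a h0 h1) F = ENNReal.ofReal (1 - a) * F 1 +
      ENNReal.ofReal a * expect (green μ a h0 h1) fun x => expect μ fun g => F (x * g) := by
  have e : ∀ G : Γ → ℝ≥0∞, expect (green μ a h0 h1) G =
    ∑' n, geom a h0 h1 n * expect (convPow μ n) G := fun G => expect_bind _ _ _
  rw [e F, e, tsum_eq_zero_add' ENNReal.summable, ← ENNReal.tsum_mul_left]
  congr 1
  · rw [convPow, expect_pure, geom_apply, pow_zero, mul_one]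
  · refine tsum_congr fun n => ?_
    rw [geom_succ, convPow, expect_conv, mul_assoc]

/-- The support of the Green measure is stable under steps of the walk. With symmetry, the two
endpoints of an edge are both charged or both null, so `Real.log 0` never enters an edge on which
only one endpoint is null. -/
lemma green_mul_ne_zero (h : 0 < a) {x g : Γ} (hx : green μ a h0 h1 x ≠ 0) (hg : μ g ≠ 0) :
    green μ a h0 h1 (x * g) ≠ 0 := by
  rw [← PMF.mem_support_iff, green, PMF.mem_support_bind_iff] at hx ⊢
  obtain ⟨n, -, hn⟩ := hx
  refine ⟨n + 1, ?_, ?_⟩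
  · rw [PMF.mem_support_iff, geom_apply, Ne, ENNReal.ofReal_eq_zero, not_le]
    exact mul_pos (by linarith) (pow_pos h _)
  · rw [PMF.mem_support_iff, convPow]
    have := mul_le_conv (convPow μ n) μ x g
    intro h'
    rw [h', nonpos_iff_eq_zero, mul_eq_zero] at this
    exact this.elim ((PMF.mem_support_iff _ _).1 hn) hg

/-- The weights contribute `-log (1 - a) - n log a`, the entropies at most `C + b n`, and the
geometric law has mean `a / (1 - a)`. -/
lemma entropyENN_green_le (h : 0 < a) (hfin : FiniteEntropy μ) {b C : ℝ} (hb : 0 ≤ b) (hC : 0 ≤ C)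
    (hH : ∀ n : ℕ, entropy (convPow μ n) ≤ C + b * n) :
    entropyENN (green μ a h0 h1) ≤
      ENNReal.ofReal ((C - Real.log (1 - a)) + (b - Real.log a) * (a / (1 - a))) := by
  have hl1 : Real.log (1 - a) ≤ 0 := Real.log_nonpos (by linarith) (by linarith)
  have hl : Real.log a ≤ 0 := Real.log_nonpos h0 h1.le
  rw [← expect_geom_affine h0 h1 (by linarith) (by linarith)]
  refine (entropyENN_bind_le _ _).trans (expect_mono fun n _ => ?_)
  have hn0 : (0 : ℝ) ≤ n := n.cast_nonneg
  have e1 : negLog (geom a h0 h1 n) = ENNReal.ofReal (-Real.log (1 - a) - Real.log a * n) := by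
    rw [negLog, geom_apply,
      ENNReal.toReal_ofReal (mul_nonneg (by linarith) (pow_nonneg h0 n)),
      Real.log_mul (by linarith) (pow_pos h n).ne', Real.log_pow]
    congr 1
    ring
  rw [e1, ← ENNReal.ofReal_toReal (entropyENN_convPow_ne_top hfin n), ← entropy_eq,
    ← ENNReal.ofReal_add (by nlinarith) (entropy_nonneg _)]
  refine ENNReal.ofReal_le_ofReal ?_
  linarith [hH n]

lemma entropyENN_green_ne_top (h : 0 < a) (hfin : FiniteEntropy μ) :
    entropyENN (green μ a h0 h1) ≠ ⊤ := by
  obtain ⟨C, hC, hH⟩ := exists_entropy_le hfin (lt_add_one (asymptoticEntropy μ))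
  exact ne_top_of_le_ne_top ofReal_ne_top (entropyENN_green_le h hfin
    (by linarith [asymptoticEntropy_nonneg hfin]) hC hH)

/-- A lower bound for the renormalized entropies of all the Green measures is a lower bound for
the asymptotic entropy. -/
lemma le_asymptoticEntropy (hfin : FiniteEntropy μ) {c : ℝ}
    (hc : ∀ (a : ℝ) (h : 0 < a) (h1 : a < 1),
      c ≤ (1 - a) / a * entropy (green μ a h.le h1)) : c ≤ asymptoticEntropy μ := by
  refine le_of_forall_gt_imp_ge_of_dense fun b hb => ?_
  have hb0 : 0 ≤ b := (asymptoticEntropy_nonneg hfin).trans hb.le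
  obtain ⟨C, hC, hH⟩ := exists_entropy_le hfin hb
  -- This function is the entropy bound multiplied by `(1 - a) / a`. It takes the value `b` at `a =
  -- 1`; continuity there rests on that of `x log x` at `0`.
  have hcont : ContinuousAt (fun a : ℝ =>
      ((1 - a) * C - (1 - a) * Real.log (1 - a)) / a + (b - Real.log a)) 1 := by
    have hm : Continuous fun a : ℝ => (1 - a) * Real.log (1 - a) :=
      Real.continuous_mul_log.comp (continuous_const.sub continuous_id)
    refine ContinuousAt.add (ContinuousAt.div ?_ continuousAt_id one_ne_zero)
      (continuousAt_const.sub (Real.continuousAt_log one_ne_zero))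
    exact ContinuousAt.sub (by fun_prop) hm.continuousAt
  have ht := hcont.tendsto
  simp only [sub_self, zero_mul, zero_div, Real.log_one, sub_zero, zero_add] at ht
  refine ge_of_tendsto (ht.mono_left (nhdsWithin_le_nhds (s := Set.Iio 1))) ?_
  filter_upwards [Ioo_mem_nhdsLT (zero_lt_one' ℝ)] with a ha
  have h1a : 0 < 1 - a := sub_pos.2 ha.2
  have ha0 := ha.1
  refine (hc a ha.1 ha.2).trans ?_
  have hl1 : Real.log (1 - a) ≤ 0 := Real.log_nonpos (by linarith) (by linarith)
  have hl : Real.log a ≤ 0 := Real.log_nonpos ha0.le ha.2.le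
  have hE : entropy (green μ a ha.1.le ha.2) ≤
      (C - Real.log (1 - a)) + (b - Real.log a) * (a / (1 - a)) := by
    rw [entropy_eq]
    refine ENNReal.toReal_le_of_le_ofReal (add_nonneg (by linarith)
      (mul_nonneg (by linarith) (by positivity))) (entropyENN_green_le ha.1 hfin hb0 hC hH)
  calc (1 - a) / a * entropy (green μ a ha.1.le ha.2) ≤ (1 - a) / a *
        ((C - Real.log (1 - a)) + (b - Real.log a) * (a / (1 - a))) := by gcongr
    _ = _ := by field_simp

/-- The involution `(x, g) ↦ (x g, g⁻¹)` reversing the oriented edges of the Cayley graph. -/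
def flip : Γ × Γ ≃ Γ × Γ where
  toFun z := (z.1 * z.2, z.2⁻¹)
  invFun z := (z.1 * z.2, z.2⁻¹)
  left_inv z := by simp
  right_inv z := by simp

lemma hasSum_add_flip {φ : Γ × Γ → ℝ} {S : ℝ} (h : HasSum φ S) :
    HasSum (fun z => φ z + φ (z.1 * z.2, z.2⁻¹)) (2 * S) := by
  rw [two_mul]
  exact h.add ((Equiv.hasSum_iff (flip (Γ := Γ))).2 h)

/-- The energy of the Green measure against a nonnegative function. -/
lemma hasSum_energy (hμ : IsSymmetric μ) (h : 0 < a) {F : Γ → ℝ} (hF : ∀ x, 0 ≤ F x)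
    (hE : expect (green μ a h0 h1) (fun x => ENNReal.ofReal (F x)) ≠ ⊤) :
    HasSum (fun z : Γ × Γ => (μ z.2).toReal *
        (((green μ a h0 h1 z.1).toReal - (green μ a h0 h1 (z.1 * z.2)).toReal) *
          (F (z.1 * z.2) - F z.1)))
      (2 * ((1 - a) / a *
        ((expect (green μ a h0 h1) (fun x => ENNReal.ofReal (F x))).toReal - F 1))) := by
  have hs := expect_green (μ := μ) (h0 := h0) (h1 := h1) fun x => ENNReal.ofReal (F x)
  set ν := green μ a h0 h1 with hν
  set E := expect ν (fun x => ENNReal.ofReal (F x)) with hEdef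
  set K := expect ν (fun x => expect μ fun g => ENNReal.ofReal (F (x * g))) with hK
  have hK' : K ≠ ⊤ := by
    intro hKt
    rw [hKt, ENNReal.mul_top (by simpa using h), add_top] at hs
    exact hE hs
  have hreal : E.toReal = (1 - a) * F 1 + a * K.toReal := by
    rw [hs, ENNReal.toReal_add (ENNReal.mul_ne_top ofReal_ne_top ofReal_ne_top)
      (ENNReal.mul_ne_top ofReal_ne_top hK'), ENNReal.toReal_mul, ENNReal.toReal_mul,
      ENNReal.toReal_ofReal (by linarith), ENNReal.toReal_ofReal (hF 1), ENNReal.toReal_ofReal h0]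
  have s1 := hasSum_prod_of_expect ν μ (f := fun x g => F (x * g)) (fun _ _ => hF _) hK'
  have s2 := hasSum_prod_of_expect ν μ (f := fun x _ => F x) (fun _ _ => hF _)
    (by simpa only [expect_const] using hE)
  simp only [expect_const] at s2
  -- Before symmetrization the sum is `K - E`, and `E = (1 - a) F(1) + a K` turns it into `(1 - a)/a
  -- · (E - F(1))`. Reversing the edges produces the factor `ν(x) - ν(xg)` and the factor 2.
  convert hasSum_add_flip (s1.sub s2) using 1
  · funext z
    simp only [hμ z.2, mul_inv_cancel_right]
    ring
  · congr 1
    rw [← hEdef, ← hK]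
    have : K.toReal = (E.toReal - (1 - a) * F 1) / a := by
      rw [hreal]; field_simp; ring
    rw [this]
    field_simp
    ring

/-- Each orientation of the edges contributes `∑ c μ`, since `ν` has mass 1. Constant `c` gives the
total edge mass; `c = |g|²` gives `2 M₂²`. -/
lemma hasSum_edge_weight (hμ : IsSymmetric μ) (ν : PMF Γ) {c : Γ → ℝ} (hc : ∀ g, 0 ≤ c g)
    (hinv : ∀ g, c g⁻¹ = c g) (hs : Summable fun g => c g * (μ g).toReal) :
    HasSum (fun z : Γ × Γ => (μ z.2).toReal *
        (((ν z.1).toReal + (ν (z.1 * z.2)).toReal) * c z.2))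
      (2 * ∑' g, c g * (μ g).toReal) := by
  have hs' := (summable_iff_expect μ hc).1 hs
  have s1 := hasSum_prod_of_expect ν μ (f := fun _ g => c g) (fun _ _ => hc _)
    (by simpa only [expect_const] using hs')
  simp only [expect_const] at s1
  rw [tsum_eq_toReal_expect μ hc]
  convert hasSum_add_flip s1 using 1
  funext z
  simp only [hμ z.2, hinv]
  ring

lemma hasSum_edge_mass (hμ : IsSymmetric μ) (ν : PMF Γ) :
    HasSum (fun z : Γ × Γ => (μ z.2).toReal *
      ((ν z.1).toReal + (ν (z.1 * z.2)).toReal)) 2 := by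
  have h := hasSum_edge_weight hμ ν (c := fun _ => 1) (fun _ => zero_le_one) (fun _ => rfl)
    (by simpa using ENNReal.summable_toReal μ.tsum_coe_ne_top)
  simp only [one_mul, mul_one] at h
  rwa [← ENNReal.tsum_toReal_eq μ.apply_ne_top, μ.tsum_coe, ENNReal.toReal_one, mul_one] at h

/-- A lower bound for the entropy production of the Green measures gives a lower bound for the
asymptotic entropy. -/
lemma le_of_pointwise (hμ : IsSymmetric μ) (hfin : FiniteEntropy μ) {c : ℝ}
    (φ : ℝ → ℝ → Γ → Γ → ℝ) (hφ0 : ∀ x g, φ 0 0 x g = 0)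
    (hφ : ∀ A B : ℝ, 0 < A → 0 < B → ∀ x g, φ A B x g ≤ (A - B) * (Real.log A - Real.log B))
    (hsum : ∀ (a : ℝ) (h : 0 < a) (h1 : a < 1), ∃ S, 2 * c ≤ S ∧
      HasSum (fun z : Γ × Γ => (μ z.2).toReal * φ (green μ a h.le h1 z.1).toReal
        (green μ a h.le h1 (z.1 * z.2)).toReal z.1 z.2) S) :
    c ≤ asymptoticEntropy μ := by
  refine le_asymptoticEntropy hfin fun a h h1 => ?_
  obtain ⟨S, hS, hsum⟩ := hsum a h h1
  have hE := hasSum_energy (h0 := h.le) (h1 := h1) hμ h (neg_log_nonneg (green μ a h.le h1))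
    (entropyENN_green_ne_top h hfin)
  have hle := hasSum_le (fun z => ?_) hsum hE
  · change S ≤ 2 * ((1 - a) / a * ((entropyENN (green μ a h.le h1)).toReal - _)) at hle
    rw [← entropy_eq] at hle
    -- The boundary term `F(e) = -log ν(e)` has a favourable sign and is dropped.
    have h2 : 0 ≤ (1 - a) / a * -Real.log (green μ a h.le h1 1).toReal :=
      mul_nonneg (div_nonneg (by linarith) h.le) (neg_log_nonneg _ _)
    rw [mul_sub] at hle
    linarith
  · obtain ⟨x, g⟩ := z
    by_cases hg : μ g = 0
    · simp [hg]
    refine mul_le_mul_of_nonneg_left ?_ ENNReal.toReal_nonneg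
    by_cases hx : green μ a h.le h1 x = 0
    · have hxg : green μ a h.le h1 (x * g) = 0 := by
        by_contra hne
        refine green_mul_ne_zero h hne ((hμ g).trans_ne hg) ?_
        rwa [mul_inv_cancel_right]
      simp [hx, hxg, hφ0]
    · refine (hφ _ _ (ENNReal.toReal_pos hx (PMF.apply_ne_top _ _))
        (ENNReal.toReal_pos (green_mul_ne_zero h hx hg) (PMF.apply_ne_top _ _)) x g).trans_eq ?_
      ring

end Green

end GroupWalk

end

noncomputable section

namespace GroupWalk

open ENNReal

/-! ### The spectral radius inequality -/

section SpectralInequality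

variable {Γ : Type*} [Group Γ] {μ : PMF Γ}

lemma spectral_le_asymptoticEntropy (hμ : IsSymmetric μ) (hfin : FiniteEntropy μ) :
    2 * √(1 - spectralRad μ ^ 2) * Real.artanh √(1 - spectralRad μ ^ 2) ≤
      asymptoticEntropy μ := by
  have hρ := spectralRad_pos hμ
  rcases (spectralRad_le_one μ).eq_or_lt with h1 | hρ1
  -- The case `ρ = 1` is separate because the tangent point `s₀` must be positive.
  · simpa [h1] using asymptoticEntropy_nonneg hfin
  have hsq : 0 < 1 - spectralRad μ ^ 2 := by nlinarith
  have hy0 : 0 < √(1 - spectralRad μ ^ 2) := Real.sqrt_pos.2 hsq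
  have hy1 : √(1 - spectralRad μ ^ 2) < 1 := by
    rw [Real.sqrt_lt' one_pos]; nlinarith
  have hmem : √(1 - spectralRad μ ^ 2) ∈ Set.Ioo (-1) 1 := ⟨by linarith, hy1⟩
  have ht := Real.tanh_artanh hmem
  have hc := Real.cosh_artanh hmem
  rw [Real.sq_sqrt hsq.le,
    show 1 - (1 - spectralRad μ ^ 2) = spectralRad μ ^ 2 by ring, Real.sqrt_sq hρ.le] at hc
  have hs₀ := Real.artanh_pos (x := √(1 - spectralRad μ ^ 2)) ⟨hy0, hy1⟩
  set s₀ := Real.artanh √(1 - spectralRad μ ^ 2)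
  have hc' : 1 / Real.cosh s₀ = spectralRad μ := by rw [hc, one_div_one_div]
  have hκ : 0 ≤ 2 * Real.cosh s₀ + 2 * s₀ / Real.sinh s₀ := by
    have := Real.sinh_pos_iff.2 hs₀
    have := Real.cosh_pos s₀
    positivity
  rw [← ht]
  set κ := 2 * Real.cosh s₀ + 2 * s₀ / Real.sinh s₀ with hκdef
  refine le_of_pointwise hμ hfin (fun A B _ _ =>
    (A + B) * (2 * s₀ * Real.tanh s₀ + κ * (1 / Real.cosh s₀)) - 2 * κ * √(A * B))
    (fun x g => by simp) (fun A B hA hB x g => spectral_pointwise hA hB hs₀) ?_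
  intro a h h1
  set ν := green μ a h.le h1
  have hp := hasSum_edge_mass hμ ν
  have hnn : ∀ z : Γ × Γ,
      0 ≤ (μ z.2).toReal * √((ν z.1).toReal * (ν (z.1 * z.2)).toReal) := fun z =>
    mul_nonneg ENNReal.toReal_nonneg (Real.sqrt_nonneg _)
  have hR : Summable fun z : Γ × Γ =>
      (μ z.2).toReal * √((ν z.1).toReal * (ν (z.1 * z.2)).toReal) :=
    summable_of_sum_le hnn (sum_sqrt_le hμ ν)
  have hR' := hR.tsum_le_of_sum_le (sum_sqrt_le hμ ν)
  refine ⟨_, ?_, ((hp.mul_left (2 * s₀ * Real.tanh s₀ + κ * (1 / Real.cosh s₀))).sub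
    (hR.hasSum.mul_left (2 * κ))).congr_fun ?_⟩
  -- The tangent point satisfies `1 / cosh s₀ = ρ`, so the sum exceeds `4 s₀ tanh s₀` by `2κ` times
  -- `ρ` minus the edge sum of square roots, which is nonnegative.
  · rw [hc']
    nlinarith
  · intro z
    ring

end SpectralInequality

/-! ### The drift inequality -/

section Drift

variable {Γ : Type*} [Group Γ] [MetricSpace Γ] {μ : PMF Γ}

lemma len_nonneg (g : Γ) : 0 ≤ len g := dist_nonneg

lemma len_one : len (1 : Γ) = 0 := dist_self 1

lemma len_inv (hinv : LeftInvariantDist Γ) (g : Γ) : len g⁻¹ = len g := by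
  rw [len, len, ← hinv g, mul_inv_cancel, mul_one, dist_comm]

lemma abs_len_mul_sub_le (hinv : LeftInvariantDist Γ) (x g : Γ) :
    |len (x * g) - len x| ≤ len g := by
  have h := abs_dist_sub_le (x * g) x 1
  have e := hinv x g 1
  rw [mul_one] at e
  rwa [e] at h

/-- The mean length as an extended nonnegative real. -/
def lengthENN (p : PMF Γ) : ℝ≥0∞ := expect p fun g => ENNReal.ofReal (len g)

lemma finiteFirstMoment_iff (p : PMF Γ) : FiniteFirstMoment p ↔ lengthENN p ≠ ⊤ :=
  summable_iff_expect p len_nonneg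

lemma meanLength_eq (p : PMF Γ) : meanLength p = (lengthENN p).toReal :=
  tsum_eq_toReal_expect p len_nonneg

lemma meanLength_nonneg (p : PMF Γ) : 0 ≤ meanLength p := by
  rw [meanLength_eq]; exact ENNReal.toReal_nonneg

lemma FiniteSecondMoment.finiteFirstMoment {p : PMF Γ} (h : FiniteSecondMoment p) :
    FiniteFirstMoment p := by
  refine Summable.of_nonneg_of_le (fun g => mul_nonneg (len_nonneg g) ENNReal.toReal_nonneg)
    (fun g => ?_) ((ENNReal.summable_toReal p.tsum_coe_ne_top).add h)
  have : len g ≤ 1 + len g ^ 2 := by nlinarith [sq_nonneg (len g - 1)]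
  nlinarith [ENNReal.toReal_nonneg (a := p g)]

lemma lengthENN_conv_le (hinv : LeftInvariantDist Γ) (p q : PMF Γ) :
    lengthENN (conv p q) ≤ lengthENN p + lengthENN q := by
  rw [lengthENN, expect_conv, ← expect_const p (lengthENN q), lengthENN, ← expect_add]
  refine expect_mono fun x _ => ?_
  rw [← expect_const q (ENNReal.ofReal (len x)), lengthENN, ← expect_add]
  refine expect_mono fun y _ => ?_
  rw [← ENNReal.ofReal_add (len_nonneg x) (len_nonneg y)]
  refine ENNReal.ofReal_le_ofReal ?_
  linarith [(abs_le.1 (abs_len_mul_sub_le hinv x y)).2]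

lemma lengthENN_convPow_le (hinv : LeftInvariantDist Γ) (μ : PMF Γ) (n : ℕ) :
    lengthENN (convPow μ n) ≤ n * lengthENN μ := by
  induction n with
  | zero => simp [convPow, lengthENN, expect_pure, len_one]
  | succ n ih =>
    rw [convPow]
    refine (lengthENN_conv_le hinv _ _).trans ?_
    push_cast
    rw [add_mul, one_mul]
    gcongr

lemma lengthENN_convPow_ne_top (hinv : LeftInvariantDist Γ) (h : FiniteFirstMoment μ) (n : ℕ) :
    lengthENN (convPow μ n) ≠ ⊤ :=
  ne_top_of_le_ne_top (ENNReal.mul_ne_top (natCast_ne_top n) ((finiteFirstMoment_iff μ).1 h))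
    (lengthENN_convPow_le hinv μ n)

lemma subadditive_meanLength (hinv : LeftInvariantDist Γ) (h : FiniteFirstMoment μ) :
    Subadditive fun n => meanLength (convPow μ n) := by
  intro m n
  simp only [meanLength_eq]
  have hm := lengthENN_convPow_ne_top hinv h m
  have hn := lengthENN_convPow_ne_top hinv h n
  rw [← ENNReal.toReal_add hm hn, convPow_add]
  exact ENNReal.toReal_mono (ENNReal.add_ne_top.2 ⟨hm, hn⟩) (lengthENN_conv_le hinv _ _)

lemma tendsto_drift (hinv : LeftInvariantDist Γ) (h : FiniteFirstMoment μ) :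
    Filter.Tendsto (fun n : ℕ => meanLength (convPow μ n) / n) Filter.atTop (nhds (drift μ)) :=
  tendsto_nhds_limUnder ⟨_, (subadditive_meanLength hinv h).tendsto_lim
    (bddBelow_div_of_nonneg fun _ => meanLength_nonneg _)⟩

lemma drift_nonneg (hinv : LeftInvariantDist Γ) (h : FiniteFirstMoment μ) : 0 ≤ drift μ :=
  ge_of_tendsto' (tendsto_drift hinv h) fun n => div_nonneg (meanLength_nonneg _) n.cast_nonneg

/-- In Fekete's lemma the limit is the infimum of the quotients, hence a lower bound at every time.
-/
lemma drift_mul_le (hinv : LeftInvariantDist Γ) (h : FiniteFirstMoment μ) (n : ℕ) :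
    drift μ * n ≤ meanLength (convPow μ n) := by
  have hsub := subadditive_meanLength hinv h
  have hbdd := bddBelow_div_of_nonneg fun n => meanLength_nonneg (convPow μ n)
  rcases n.eq_zero_or_pos with rfl | hn
  · simpa using meanLength_nonneg _
  · rw [tendsto_nhds_unique (tendsto_drift hinv h) (hsub.tendsto_lim hbdd),
      ← le_div_iff₀ (by exact_mod_cast hn)]
    exact hsub.lim_le_div hbdd hn.ne'

variable {a : ℝ} {h0 : 0 ≤ a} {h1 : a < 1}

lemma lengthENN_green : lengthENN (green μ a h0 h1) =
    expect (geom a h0 h1) fun n => lengthENN (convPow μ n) := expect_bind _ _ _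

lemma lengthENN_green_ne_top (hinv : LeftInvariantDist Γ) (h : FiniteFirstMoment μ) :
    lengthENN (green μ a h0 h1) ≠ ⊤ := by
  have hle : lengthENN (green μ a h0 h1) ≤
      expect (geom a h0 h1) fun n => ENNReal.ofReal (0 + meanLength μ * n) := by
    rw [lengthENN_green]
    refine expect_mono fun n _ => (lengthENN_convPow_le hinv μ n).trans_eq ?_
    rw [zero_add, ENNReal.ofReal_mul (meanLength_nonneg μ), meanLength_eq,
      ENNReal.ofReal_toReal ((finiteFirstMoment_iff μ).1 h), ENNReal.ofReal_natCast, mul_comm]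
  rw [expect_geom_affine h0 h1 le_rfl (meanLength_nonneg μ)] at hle
  exact ne_top_of_le_ne_top ofReal_ne_top hle

/-- The drift is at most the renormalized mean length of the Green measures. -/
lemma drift_le_green (ha : 0 < a) (hinv : LeftInvariantDist Γ) (h : FiniteFirstMoment μ) :
    drift μ ≤ (1 - a) / a * (lengthENN (green μ a h0 h1)).toReal := by
  have hle : expect (geom a h0 h1) (fun n => ENNReal.ofReal (0 + drift μ * n)) ≤
      lengthENN (green μ a h0 h1) := by
    rw [lengthENN_green]
    refine expect_mono fun n _ => ?_
    rw [zero_add, ← ENNReal.ofReal_toReal (lengthENN_convPow_ne_top hinv h n), ← meanLength_eq]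
    exact ENNReal.ofReal_le_ofReal (drift_mul_le hinv h n)
  rw [expect_geom_affine h0 h1 le_rfl (drift_nonneg hinv h), zero_add,
    ENNReal.ofReal_le_iff_le_toReal (lengthENN_green_ne_top hinv h)] at hle
  have h1a : 0 < 1 - a := by linarith
  calc drift μ = (1 - a) / a * (drift μ * (a / (1 - a))) := by field_simp
    _ ≤ _ := by gcongr

/-- Summing the pointwise bound gives at least `4 s₀ y + 4 K y (ℓ / M₂ - y)` with `y = tanh s₀`.
Only `y ≤ ℓ / M₂` is required, so `s₀` stays free; this also serves to exclude `ℓ ≥ M₂`. -/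
lemma drift_le_asymptoticEntropy (hinv : LeftInvariantDist Γ) (hμ : IsSymmetric μ)
    (hfin : FiniteEntropy μ) (h2 : FiniteSecondMoment μ) (hM : 0 < M2 μ) {s₀ : ℝ} (hs₀ : 0 < s₀)
    (hle : Real.tanh s₀ * M2 μ ≤ drift μ) :
    2 * s₀ * Real.tanh s₀ ≤ asymptoticEntropy μ := by
  have hS := Real.sinh_pos_iff.2 hs₀
  have hC := Real.cosh_pos s₀
  have hK : 0 ≤ Real.cosh s₀ ^ 2 + s₀ * Real.cosh s₀ / Real.sinh s₀ := by positivity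
  have hy : 0 ≤ Real.tanh s₀ := by rw [Real.tanh_eq_sinh_div_cosh]; positivity
  refine le_of_pointwise hμ hfin (fun A B x g =>
    (A + B) * (2 * s₀ * Real.tanh s₀ -
        (Real.cosh s₀ ^ 2 + s₀ * Real.cosh s₀ / Real.sinh s₀) * Real.tanh s₀ ^ 2 *
          (1 + (len g / M2 μ) ^ 2)) +
      2 * (Real.cosh s₀ ^ 2 + s₀ * Real.cosh s₀ / Real.sinh s₀) * Real.tanh s₀ *
        ((A - B) * ((len (x * g) - len x) / M2 μ)))
    (fun x g => by simp) (fun A B hA hB x g => drift_pointwise hA hB hs₀ ?_) ?_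
  · rw [abs_div, abs_of_pos hM]
    exact div_le_div_of_nonneg_right (abs_len_mul_sub_le hinv x g) hM.le
  set K := Real.cosh s₀ ^ 2 + s₀ * Real.cosh s₀ / Real.sinh s₀
  set y := Real.tanh s₀
  intro a h h1
  set ν := green μ a h.le h1 with hν
  have hp := hasSum_edge_mass hμ ν
  have hq := hasSum_edge_weight hμ ν (c := fun g => len g ^ 2) (fun _ => sq_nonneg _)
    (fun g => by rw [len_inv hinv]) h2
  have hM2 : ∑' g, len g ^ 2 * (μ g).toReal = M2 μ ^ 2 := by
    rw [M2, Real.sq_sqrt (tsum_nonneg fun g => mul_nonneg (sq_nonneg _) ENNReal.toReal_nonneg)]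
  rw [hM2] at hq
  have hl := hasSum_energy (h0 := h.le) (h1 := h1) hμ h len_nonneg
    (lengthENN_green_ne_top hinv h2.finiteFirstMoment)
  have hd := drift_le_green (h0 := h.le) (h1 := h1) h hinv h2.finiteFirstMoment
  change HasSum _ (2 * ((1 - a) / a * ((lengthENN ν).toReal - len 1))) at hl
  rw [len_one, sub_zero] at hl
  rw [← hν] at hd
  set L := (1 - a) / a * (lengthENN ν).toReal
  refine ⟨_, ?_, (((hp.mul_left (2 * s₀ * y - K * y ^ 2)).sub
    (hq.mul_left (K * y ^ 2 / M2 μ ^ 2))).add (hl.mul_left (2 * K * y / M2 μ))).congr_fun ?_⟩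
  · have e : K * y ^ 2 / M2 μ ^ 2 * (2 * M2 μ ^ 2) = 2 * (K * y ^ 2) := by field_simp
    have e2 : 2 * K * y / M2 μ * (2 * L) = 4 * (K * y) * (L / M2 μ) := by ring
    have h3 : y ≤ L / M2 μ := by rw [le_div_iff₀ hM]; exact hle.trans hd
    have h4 := mul_le_mul_of_nonneg_left h3 (mul_nonneg hK hy)
    rw [e, e2]
    nlinarith
  · intro z
    field_simp
    ring

lemma normDrift_nonneg (hinv : LeftInvariantDist Γ) (h : FiniteFirstMoment μ) :
    0 ≤ normDrift μ := div_nonneg (drift_nonneg hinv h) (Real.sqrt_nonneg _)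

/-- If `ℓ ≥ M₂ > 0`, every `s₀ > 0` is admissible in `drift_le_asymptoticEntropy`, and `2 s₀ tanh
s₀` is unbounded while `h` is finite. -/
lemma normDrift_lt_one (hinv : LeftInvariantDist Γ) (hμ : IsSymmetric μ)
    (hfin : FiniteEntropy μ) (h2 : FiniteSecondMoment μ) : normDrift μ < 1 := by
  by_contra! hge
  have hM : 0 < M2 μ := (Real.sqrt_nonneg _).lt_of_ne fun h => by
    norm_num [normDrift, M2, ← h] at hge
  rw [normDrift, one_le_div hM] at hge
  have hh := asymptoticEntropy_nonneg hfin
  have ht1 : 0 < Real.tanh 1 := by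
    rw [Real.tanh_eq_sinh_div_cosh]
    exact div_pos (Real.sinh_pos_iff.2 one_pos) (Real.cosh_pos 1)
  -- Since `s ≥ 1`, `2 s tanh s ≥ 2 s tanh 1 = 2 (h + tanh 1) > h`.
  set s := asymptoticEntropy μ / Real.tanh 1 + 1 with hs
  have hs1 : 1 ≤ s := by
    have : 0 ≤ asymptoticEntropy μ / Real.tanh 1 := by positivity
    linarith
  have hmono : Real.tanh 1 ≤ Real.tanh s := by
    rwa [← Real.artanh_le_artanh_iff ⟨Real.neg_one_lt_tanh 1, Real.tanh_lt_one 1⟩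
      ⟨Real.neg_one_lt_tanh s, Real.tanh_lt_one s⟩,
      Real.artanh_tanh, Real.artanh_tanh]
  have key := drift_le_asymptoticEntropy hinv hμ hfin h2 hM (by linarith : 0 < s)
    (by nlinarith [Real.tanh_lt_one s])
  have h3 : s * Real.tanh 1 = asymptoticEntropy μ + Real.tanh 1 := by
    rw [hs, add_mul, div_mul_cancel₀ _ ht1.ne', one_mul]
  nlinarith

lemma normDrift_le_asymptoticEntropy (hinv : LeftInvariantDist Γ) (hμ : IsSymmetric μ)
    (hfin : FiniteEntropy μ) (h2 : FiniteSecondMoment μ) :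
    2 * normDrift μ * Real.artanh (normDrift μ) ≤ asymptoticEntropy μ := by
  have h1 := normDrift_lt_one hinv hμ hfin h2
  rcases (normDrift_nonneg hinv h2.finiteFirstMoment).eq_or_lt with h0 | h0
  · simpa [← h0] using asymptoticEntropy_nonneg hfin
  have hM : 0 < M2 μ := (Real.sqrt_nonneg _).lt_of_ne fun h => by
    simp [normDrift, M2, ← h] at h0
  have ht := Real.tanh_artanh (x := normDrift μ) ⟨by linarith, h1⟩
  have key := drift_le_asymptoticEntropy hinv hμ hfin h2 hM (Real.artanh_pos ⟨h0, h1⟩)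
    (by rw [ht, normDrift, div_mul_cancel₀ _ hM.ne'])
  rw [ht] at key
  linarith

end Drift

end GroupWalk

end

theorem theorem1p2 {Γ : Type*} [Group Γ] [Countable Γ] [MetricSpace Γ]
    (hinv : GroupWalk.LeftInvariantDist Γ) (hproper : GroupWalk.ProperDist Γ)
    (μ : PMF Γ) (hsymm : GroupWalk.IsSymmetric μ) (hent : GroupWalk.FiniteEntropy μ) :
    -- the asymptotic entropy is well defined
    ((∀ n : ℕ, GroupWalk.FiniteEntropy (GroupWalk.convPow μ n)) ∧
      Filter.Tendsto (fun n : ℕ => GroupWalk.entropy (GroupWalk.convPow μ n) / n) Filter.atTop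
        (nhds (GroupWalk.asymptoticEntropy μ))) ∧
    -- the inequality for the spectral radius, where `√(1 - ρ²)` lies in `[0, 1)`
    (0 < GroupWalk.spectralRad μ ∧ GroupWalk.spectralRad μ ≤ 1 ∧
      2 * Real.sqrt (1 - GroupWalk.spectralRad μ ^ 2) *
          Real.artanh (Real.sqrt (1 - GroupWalk.spectralRad μ ^ 2)) ≤
        GroupWalk.asymptoticEntropy μ) ∧
    -- the drift is well defined and satisfies the inequality, where `ℓ / M₂(μ)` lies in `[0, 1)`
    (GroupWalk.FiniteSecondMoment μ →
      ((∀ n : ℕ, GroupWalk.FiniteFirstMoment (GroupWalk.convPow μ n)) ∧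
        Filter.Tendsto (fun n : ℕ => GroupWalk.meanLength (GroupWalk.convPow μ n) / n)
          Filter.atTop (nhds (GroupWalk.drift μ))) ∧
      0 ≤ GroupWalk.normDrift μ ∧ GroupWalk.normDrift μ < 1 ∧
      2 * GroupWalk.normDrift μ * Real.artanh (GroupWalk.normDrift μ) ≤
        GroupWalk.asymptoticEntropy μ) := by

  refine ⟨⟨fun n => (GroupWalk.finiteEntropy_iff _).2 (GroupWalk.entropyENN_convPow_ne_top hent n),
    GroupWalk.tendsto_entropy hent⟩,
    ⟨GroupWalk.spectralRad_pos hsymm, GroupWalk.spectralRad_le_one μ,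
      GroupWalk.spectral_le_asymptoticEntropy hsymm hent⟩,
    fun h2 => ⟨⟨fun n => (GroupWalk.finiteFirstMoment_iff _).2
      (GroupWalk.lengthENN_convPow_ne_top hinv h2.finiteFirstMoment n),
      GroupWalk.tendsto_drift hinv h2.finiteFirstMoment⟩,
      GroupWalk.normDrift_nonneg hinv h2.finiteFirstMoment,
      GroupWalk.normDrift_lt_one hinv hsymm hent h2,
      GroupWalk.normDrift_le_asymptoticEntropy hinv hsymm hent h2⟩⟩
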